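/- **Theorem 3.4 (IRM-calc has feasible interpolation).** Consider prenex QBFs $$\mathcal F=\exists \vec p\,\mathcal Q\vec q\,\mathcal Q\vec r\,[A(\vec p,\vec q)\wedge B(\vec p,\vec r)],$$ where $\vec p,\vec q,\vec r$ are disjoint finite lists of distinct Boolean variables, $\vec q$ and $\vec r$ are quantified arbitrarily, $A$ is a CNF in the variables $\vec p,\vec q$, $B$ is a CNF in the variables $\vec p,\vec r$, and no clause contains a variable together with its negation. There are a computable procedure and a polynomial $P$ such that, for every such $\mathcal F$ (given with its parts $\vec p,\mathcal Q\vec q,\mathcal Q\vec r,A,B$) and every IRM-calc refutation $\pi$ of $\mathcal F$, the procedure outputs on input $(\mathcal F,\pi)$ a Boolean circuit $G$ (with constants, negations, and binary conjunctions and disjunctions) whose inputs are among $\vec p$, with at most $P(|\pi|)$ gates, where $|\pi|$ is the number of lines of $\pi$, such that for every $\vec a\in\{0,1\}^{\vec p}$ $$G(\vec a)=0\implies \mathcal Q\vec q.\,A(\vec a,\vec q)\text{ is false},\qquad G(\vec a)=1\implies \mathcal Q\vec r.\,B(\vec a,\vec r)\text{ is false}.$$ Here IRM-calc is the following system. An annotated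 clause is a finite set of annotated literals $l^{\sigma}$, with $l$ an existential literal and $\sigma$ a partial assignment of values $0,1,*$ to universal variables. Write $l^{[\sigma]}$ for $l$ annotated by the restriction of $\sigma$ to the variables quantified before the variable of $l$ (values $0,1,*$ are all kept), $\sigma\circ\tau$ for the assignment that is $\sigma$ on $\mathrm{dom}(\sigma)$ and $\tau$ on $\mathrm{dom}(\tau)\setminus\mathrm{dom}(\sigma)$, and $\mathrm{inst}(\tau,C)=\{l^{[\sigma\circ\tau]} : l^\sigma\in C\}$. The rules are: * Axiom: for a clause $C$ of the matrix, infer $\{l^{[\tau]} : l\in C \text{ existential}\}$, where $\tau$ is the assignment with domain the universal variables of $C$ that falsifies all universal literals of $C$. * Instantiation: from $C$ infer $\mathrm{inst}(\tau,C)$, where $\tau$ is a partial $\{0,1\}$-assignment to universal variables. * Resolution: from $x^{\tau\cup\xi}\vee C_1$ and $\neg x^{\tau\cup\sigma}\vee C_2$ infer $\mathrm{inst}(\sigma,C_1)\cup\mathrm{inst}(\xi,C_2)$, where $\mathrm{dom}(\tau),\mathrm{dom}(\xi),\mathrm{dom}(\sigma)$ are pairwise disjoint and $\tau$ has values in $\{0,1\}$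 only. * Merging: from $C\vee b^\mu\vee b^\sigma$ with $\mathrm{dom}(\mu)=\mathrm{dom}(\sigma)$ infer $C\vee b^\xi$, where $\mathrm{dom}(\xi)=\mathrm{dom}(\mu)$, $\xi(u)=\mu(u)$ if $\mu(u)=\sigma(u)$, and $\xi(u)=*$ otherwise. A refutation is a finite sequence of annotated clauses (lines) ending in the empty clause, each obtained by one of the rules from earlier lines and recorded together with the rule used, its parent lines, and its matrix clause or pivot variable. -/

import Mathlib

namespace IRMCalc

/-! ## Quantified Boolean formulas -/

/-- A literal is a variable (a natural number) with a sign: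
`(x, true)` is `x` and `(x, false)` is `¬ x`. -/
abbrev Literal := ℕ × Bool

/-- A clause, read as the set (disjunction) of its literals. -/
abbrev Clause := List Literal

/-- A formula in conjunctive normal form. -/
abbrev CNF := List Clause

/-- The two quantifiers. -/
inductive Quant
  | ex
  | all
  deriving DecidableEq

/-- A quantifier prefix, outermost quantifier first. -/
abbrev Prefix := List (Quant × ℕ)

/-- The variables of a prefix in the order of quantification. -/
def Prefix.vars (Q : Prefix) : List ℕ := Q.map Prod.snd

/-- The index of a variable is its position in the prefix; this is `ind u < ind x`. -/
def Prefix.Before (Q : Prefix) (u x : ℕ) : Prop := Q.vars.idxOf u < Q.vars.idxOf x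

/-- Satisfaction of a CNF by a total assignment. -/
def CNF.Sat (φ : CNF) (α : ℕ → Bool) : Prop := ∀ C ∈ φ, ∃ l ∈ C, α l.1 = l.2

/-- Truth of `Q. φ`, the free variables being evaluated by `α`. -/
def QTrue (φ : CNF) : Prefix → (ℕ → Bool) → Prop
  | [], α => φ.Sat α
  | (Quant.ex, x) :: Q, α => ∃ b, QTrue φ Q (Function.update α x b)
  | (Quant.all, x) :: Q, α => ∀ b, QTrue φ Q (Function.update α x b)

/-- A formula `∃ p. Q q. Q r. [A(p, q) ∧ B(p, r)]`, given with its parts. -/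
structure SplitQBF where
  p : List ℕ
  q : Prefix
  r : Prefix
  A : CNF
  B : CNF

/-- The whole quantifier prefix `∃ p. Q q. Q r`. -/
def SplitQBF.quants (F : SplitQBF) : Prefix :=
  F.p.map (fun x => (Quant.ex, x)) ++ F.q ++ F.r

/-- The whole matrix `A ∧ B`. -/
def SplitQBF.matrix (F : SplitQBF) : CNF := F.A ++ F.B

/-- The quantified variables are pairwise distinct (in particular `p`, `q`, `r` are disjoint),
`A` uses only variables of `p` and `q`, `B` uses only variables of `p` and `r`,
and no clause is tautological. -/
structure SplitQBF.WellFormed (F : SplitQBF) : Prop where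
  nodup : F.quants.vars.Nodup
  vars_A : ∀ C ∈ F.A, ∀ l ∈ C, l.1 ∈ F.p ∨ l.1 ∈ F.q.vars
  vars_B : ∀ C ∈ F.B, ∀ l ∈ C, l.1 ∈ F.p ∨ l.1 ∈ F.r.vars
  not_taut : ∀ C ∈ F.matrix, ∀ x, ¬ ((x, true) ∈ C ∧ (x, false) ∈ C)

/-! ## Annotated clauses -/

/-- The values that an annotation may give to a universal variable: `0`, `1` or `*`. -/
inductive Val
  | zero
  | one
  | star
  deriving DecidableEq

/-- An annotation: a partial assignment of `0`, `1`, `*`; `none` means not in the domain. -/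
abbrev Ann := ℕ → Option Val

/-- An annotated literal `l^σ`. -/
abbrev AnnLit := Literal × Ann

/-- An annotated clause is a set of annotated literals. -/
abbrev AnnClause := Set AnnLit

/-- The domain of a partial assignment. -/
def Ann.dom (σ : Ann) : Set ℕ := {u | σ u ≠ none}

/-- The range of the partial assignment is contained in `{0, 1}`. -/
def Ann.ZeroOne (σ : Ann) : Prop := ∀ u, σ u ≠ some Val.star

/-- The completion of `σ` by `τ`: follow `σ` on its domain and `τ` elsewhere. For disjoint
domains this is the union of the two assignments. -/
def Ann.complete (σ τ : Ann) : Ann := fun u => (σ u).or (τ u)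

open Classical in
/-- The annotated literal `l^[σ]`: keep only what `σ` assigns to variables quantified
before `l`. -/
noncomputable def restrictLit (Q : Prefix) (l : Literal) (σ : Ann) : AnnLit :=
  (l, fun u => if Q.Before u l.1 then σ u else none)

/-- `inst(τ, C)`, the set of all `l^[σ completed by τ]` for `l^σ ∈ C`. -/
def instantiate (Q : Prefix) (τ : Ann) (C : AnnClause) : AnnClause :=
  {m | ∃ l σ, (l, σ) ∈ C ∧ m = restrictLit Q l (Ann.complete σ τ)}

open Classical in
/-- The assignment that falsifies every universal literal of the clause `C`. -/
noncomputable def falsifier (Q : Prefix) (C : Clause) : Ann := fun u =>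
  if (Quant.all, u) ∈ Q ∧ (u, true) ∈ C then some Val.zero
  else if (Quant.all, u) ∈ Q ∧ (u, false) ∈ C then some Val.one
  else none

/-- The annotation obtained by merging `μ` and `σ`: common values are kept, different values
are merged to `*`. -/
def Ann.merge (μ σ : Ann) : Ann := fun u =>
  match μ u, σ u with
  | some c, some d => if c = d then some c else some Val.star
  | _, _ => none

/-! ## The rules of IRM-calc -/

/-- Axiom rule: the annotated clause obtained from the matrix clause `C`. -/
def axiomClause (Q : Prefix) (C : Clause) : AnnClause :=
  {m | ∃ l ∈ C, (Quant.ex, l.1) ∈ Q ∧ m = restrictLit Q l (falsifier Q C)}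

/-- Instantiation rule: `E` is inferred from `D`. -/
def InstRule (Q : Prefix) (D E : AnnClause) : Prop :=
  ∃ τ : Ann, (∀ u ∈ τ.dom, (Quant.all, u) ∈ Q) ∧ τ.ZeroOne ∧ E = instantiate Q τ D

/-- Resolution rule with pivot `x`: `E` is inferred from `D₁` and `D₂`. -/
def ResRule (Q : Prefix) (x : ℕ) (D₁ D₂ E : AnnClause) : Prop :=
  ∃ (τ ξ σ : Ann) (C₁ C₂ : AnnClause),
    Disjoint τ.dom ξ.dom ∧ Disjoint τ.dom σ.dom ∧ Disjoint ξ.dom σ.dom ∧ τ.ZeroOne ∧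
    D₁ = insert ((x, true), Ann.complete τ ξ) C₁ ∧
    D₂ = insert ((x, false), Ann.complete τ σ) C₂ ∧
    E = instantiate Q σ C₁ ∪ instantiate Q ξ C₂

/-- Merging rule: `E` is inferred from `D`. -/
def MergeRule (D E : AnnClause) : Prop :=
  ∃ (b : Literal) (μ σ : Ann) (C : AnnClause),
    μ.dom = σ.dom ∧ D = insert (b, μ) (insert (b, σ) C) ∧ E = insert (b, Ann.merge μ σ) C

/-! ## Proofs as finite objects -/

/-- The inference by which a line is obtained: an axiom from a matrix clause, an instantiation
of, or a merging in, the line with the given number, or a resolution of two lines (the first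
contains the positive pivot literal) on the given pivot variable. -/
inductive Inference
  | ax (C : Clause)
  | inst (i : ℕ)
  | res (i j x : ℕ)
  | merge (i : ℕ)

/-- An annotation written down as a finite list. -/
abbrev AnnCode := List (ℕ × Val)

/-- The partial assignment that is written down (the first entry of a variable counts). -/
def AnnCode.toAnn (s : AnnCode) : Ann := fun u => List.lookup u s

/-- A line of a proof: an annotated clause, written down as a list, and its inference. -/
structure Line where
  code : List (Literal × AnnCode)
  inference : Inference

/-- The annotated clause of a line. -/
def Line.clause (L : Line) : AnnClause := {m | ∃ c ∈ L.code, m = (c.1, AnnCode.toAnn c.2)}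

/-- A proof, i.e. a sequence of lines. -/
abbrev Proof := List Line

/-- The line `L` follows from the matrix `φ` and the lines `prev` before it. -/
def Line.Follows (Q : Prefix) (φ : CNF) (prev : List Line) (L : Line) : Prop :=
  match L.inference with
  | .ax C => C ∈ φ ∧ L.clause = axiomClause Q C
  | .inst i => ∃ P, prev[i]? = some P ∧ InstRule Q P.clause L.clause
  | .res i j x => ∃ P₁ P₂, prev[i]? = some P₁ ∧ prev[j]? = some P₂ ∧
      ResRule Q x P₁.clause P₂.clause L.clause
  | .merge i => ∃ P, prev[i]? = some P ∧ MergeRule P.clause L.clause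

/-- `π` is an IRM-calc refutation of `Q. φ`: every line follows from earlier ones, and the last
line is the empty clause. -/
def IsRefutation (Q : Prefix) (φ : CNF) (π : Proof) : Prop :=
  (∀ (k : ℕ) (L : Line), π[k]? = some L → L.Follows Q φ (π.take k)) ∧
  ∃ L : Line, π.getLast? = some L ∧ L.clause = ∅

/-- The size of a proof is the number of its lines. -/
def Proof.size (π : Proof) : ℕ := π.length

/-! ## Boolean circuits -/

/-- A gate; natural-number arguments of `not`, `and`, `or` are numbers of other gates. -/
inductive Gate
  | const (b : Bool)
  | input (x : ℕ)
  | not (i : ℕ)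
  | and (i j : ℕ)
  | or (i j : ℕ)

/-- A circuit: a topologically sorted sequence of gates, the last one is the output. -/
abbrev Circuit := List Gate

/-- The value of a gate, given the values of the earlier gates. -/
def Gate.eval (a : ℕ → Bool) (vals : List Bool) : Gate → Bool
  | .const b => b
  | .input x => a x
  | .not i => !(vals.getD i false)
  | .and i j => vals.getD i false && vals.getD j false
  | .or i j => vals.getD i false || vals.getD j false

/-- The values of all gates. -/
def Circuit.values (a : ℕ → Bool) (G : Circuit) : List Bool :=
  G.foldl (fun vals g => vals ++ [g.eval a vals]) []

/-- The value of the output gate. -/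
def Circuit.eval (G : Circuit) (a : ℕ → Bool) : Bool := (G.values a).getLastD false

/-- The gate with number `k` reads only gates with smaller numbers, and only inputs in `X`. -/
def Gate.Admissible (X : List ℕ) (k : ℕ) : Gate → Prop
  | .const _ => True
  | .input x => x ∈ X
  | .not i => i < k
  | .and i j => i < k ∧ j < k
  | .or i j => i < k ∧ j < k

/-- `G` is a circuit with input variables in `X`. -/
def Circuit.WellFormed (X : List ℕ) (G : Circuit) : Prop :=
  G ≠ [] ∧ ∀ (k : ℕ) (g : Gate), G[k]? = some g → g.Admissible X k

/-- The size of a circuit is the number of its gates, constants and inputs included. -/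
def Circuit.size (G : Circuit) : ℕ := G.length

/-- `G` is an interpolation circuit for `F`. -/
def IsInterpolationCircuit (F : SplitQBF) (G : Circuit) : Prop :=
  G.WellFormed F.p ∧
  ∀ a : ℕ → Bool,
    (G.eval a = false → ¬ QTrue F.A F.q a) ∧ (G.eval a = true → ¬ QTrue F.B F.r a)

/-! ## Codings of the finite objects, for the notion of a computable function -/

def Quant.equiv : Quant ≃ Bool where
  toFun | .ex => false | .all => true
  invFun | false => .ex | true => .all
  left_inv := by rintro (_ | _) <;> rfl
  right_inv := by rintro (_ | _) <;> rfl

instance : Primcodable Quant := Primcodable.ofEquiv Bool Quant.equiv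

def Val.equiv : Val ≃ Option Bool where
  toFun | .zero => some false | .one => some true | .star => none
  invFun | some false => .zero | some true => .one | none => .star
  left_inv := by rintro (_ | _ | _) <;> rfl
  right_inv := by rintro (_ | _ | _) <;> rfl

instance : Primcodable Val := Primcodable.ofEquiv (Option Bool) Val.equiv

def SplitQBF.equiv : SplitQBF ≃ List ℕ × Prefix × Prefix × CNF × CNF where
  toFun F := (F.p, F.q, F.r, F.A, F.B)
  invFun t := ⟨t.1, t.2.1, t.2.2.1, t.2.2.2.1, t.2.2.2.2⟩
  left_inv _ := rfl
  right_inv _ := rfl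

instance : Primcodable SplitQBF := Primcodable.ofEquiv _ SplitQBF.equiv

def Inference.equiv : Inference ≃ Clause ⊕ ℕ ⊕ (ℕ × ℕ × ℕ) ⊕ ℕ where
  toFun
    | .ax C => .inl C
    | .inst i => .inr (.inl i)
    | .res i j x => .inr (.inr (.inl (i, j, x)))
    | .merge i => .inr (.inr (.inr i))
  invFun
    | .inl C => .ax C
    | .inr (.inl i) => .inst i
    | .inr (.inr (.inl (i, j, x))) => .res i j x
    | .inr (.inr (.inr i)) => .merge i
  left_inv := by rintro (_ | _ | _ | _) <;> rfl
  right_inv := by rintro (_ | _ | ⟨_, _, _⟩ | _) <;> rfl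

instance : Primcodable Inference := Primcodable.ofEquiv _ Inference.equiv

def Line.equiv : Line ≃ List (Literal × AnnCode) × Inference where
  toFun L := (L.code, L.inference)
  invFun t := ⟨t.1, t.2⟩
  left_inv _ := rfl
  right_inv _ := rfl

instance : Primcodable Line := Primcodable.ofEquiv _ Line.equiv

def Gate.equiv : Gate ≃ Bool ⊕ ℕ ⊕ ℕ ⊕ (ℕ × ℕ) ⊕ (ℕ × ℕ) where
  toFun
    | .const b => .inl b
    | .input x => .inr (.inl x)
    | .not i => .inr (.inr (.inl i))
    | .and i j => .inr (.inr (.inr (.inl (i, j))))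
    | .or i j => .inr (.inr (.inr (.inr (i, j))))
  invFun
    | .inl b => .const b
    | .inr (.inl x) => .input x
    | .inr (.inr (.inl i)) => .not i
    | .inr (.inr (.inr (.inl (i, j)))) => .and i j
    | .inr (.inr (.inr (.inr (i, j)))) => .or i j
  left_inv := by rintro (_ | _ | _ | _ | _) <;> rfl
  right_inv := by rintro (_ | _ | _ | ⟨_, _⟩ | ⟨_, _⟩) <;> rfl

instance : Primcodable Gate := Primcodable.ofEquiv _ Gate.equiv

end IRMCalc

/-! Fix an assignment `a` of the variables `p`. Every line of the refutation receives a bit telling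
on which half of the matrix its clause is `Valid`: 0 for `A`, 1 for `B`. Validity means that `a`
satisfies a literal on `p`, or that the universal player wins the game `Win` on the prefix of that
half. At a universal variable the player either commits to a bit, and keeps the literals carrying
that value or `*` there, or stays uncommitted, which requires winning for both bits and keeps only
the literals not annotated there. For the empty clause a win says exactly that the quantified half
is false.

The rules preserve validity on each half separately. Instantiation and merging are `Win.of_covers`:
the old strategy still works once its uncommitted rounds are specialised to the instantiating value.
Resolution is `Win.resolve`: the strategies for the two premises are run in parallel up to the
pivot.

The bits combine as follows (`Line.Follows.interpolates`). For a pivot in `p`, its value under `a`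
selects the premise whose pivot literal is false. For a pivot in `q`, validity for `A` needs both
premises, while one premise suffices for `B`, where the pivot plays no role; so the bit is a
disjunction. For the remaining pivots it is dually a conjunction. This costs five gates per line.
The strategies are never computed: the gates depend only on the recorded inferences and on the parts
of the formula, so the extraction is primitive recursive. -/

namespace IRMCalc

/-! ## A game semantics of annotated clauses -/

/-- The annotation value `v` is compatible with the truth value `b`. -/
def Val.Matches (v : Val) (b : Bool) : Prop := v = .star ∨ v = if b then .one else .zero

theorem Val.exists_matches (v : Val) : ∃ b, v.Matches b := by
  cases v
  · exact ⟨false, .inr rfl⟩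
  · exact ⟨true, .inr rfl⟩
  · exact ⟨true, .inl rfl⟩

/-- A value other than `*` determines the bit. This is why the common part `τ` of the two pivot
annotations in resolution must be free of `*`. -/
theorem Val.Matches.eq_of_ne_star {v : Val} {b c : Bool} (hv : v ≠ .star)
    (hb : v.Matches b) (hc : v.Matches c) : b = c := by
  cases v <;> cases b <;> cases c <;> simp_all [Val.Matches]

/-- `w` is obtained from `v` by possibly replacing a value by `*`. -/
def StarLE (v w : Option Val) : Prop := w = v ∨ (v ≠ none ∧ w = some .star)

theorem StarLE.refl (v : Option Val) : StarLE v v := .inl rfl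

theorem StarLE.eq_none {v w : Option Val} (h : StarLE v w) (hv : v = none) : w = none := by
  rcases h with h | h
  · exact h.trans hv
  · exact absurd hv h.1

theorem StarLE.matches {v w : Option Val} {b : Bool} (h : StarLE v w)
    (hv : ∃ c, v = some c ∧ c.Matches b) : ∃ c, w = some c ∧ c.Matches b := by
  rcases h with h | h
  · exact h ▸ hv
  · exact ⟨_, h.2, .inl rfl⟩

/-- The annotated literals whose annotation at `u` is compatible with the truth value `b`. -/
def AnnClause.selectVal (C : AnnClause) (u : ℕ) (b : Bool) : AnnClause :=
  {m ∈ C | ∃ c, m.2 u = some c ∧ c.Matches b}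

/-- The annotated literals whose annotation is undefined at `u`. -/
def AnnClause.selectNone (C : AnnClause) (u : ℕ) : AnnClause := {m ∈ C | m.2 u = none}

/-- The universal player can play on `Q` so that `φ` is falsified or a literal of `C`, whose
annotation is compatible with the choices of the universal player, is satisfied. -/
def Win (φ : CNF) : Prefix → (ℕ → Bool) → AnnClause → Prop
  | [], α, _ => ¬ φ.Sat α
  | (Quant.ex, x) :: Q, α, C =>
      ∀ b, (∃ σ, ((x, b), σ) ∈ C) ∨ Win φ Q (Function.update α x b) C
  | (Quant.all, u) :: Q, α, C =>
      (∃ b, Win φ Q (Function.update α u b) (C.selectVal u b)) ∨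
      ∀ b, Win φ Q (Function.update α u b) (C.selectNone u)

/-- Selection keeps an empty clause empty, and no existential move can hit it, so the strategy can
only end by falsifying `φ`. -/
theorem Win.not_qTrue {φ : CNF} {Q : Prefix} {α : ℕ → Bool} {C : AnnClause}
    (h : Win φ Q α C) (hC : C = ∅) : ¬ QTrue φ Q α := by
  induction Q generalizing α C with
  | nil => exact h
  | cons y Q ih =>
    obtain ⟨_ | _, x⟩ := y
    · rintro ⟨b, hb⟩
      rcases h b with ⟨σ, hσ⟩ | h
      · simp [hC] at hσ
      · exact ih h hC hb
    · intro hq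
      rcases h with ⟨b, h⟩ | h
      · exact ih h (by simp [hC, AnnClause.selectVal]) (hq b)
      · exact ih (h true) (by simp [hC, AnnClause.selectNone]) (hq true)

theorem Prefix.mem_vars {Q : Prefix} {k : Quant} {x : ℕ} (h : (k, x) ∈ Q) : x ∈ Q.vars :=
  List.mem_map.2 ⟨_, h, rfl⟩

theorem Prefix.before_head {Q : Prefix} {k : Quant} {u x : ℕ} (h : x ≠ u) :
    Prefix.Before ((k, u) :: Q) u x := by
  simp [Prefix.Before, Prefix.vars, List.idxOf_cons_ne _ h.symm]

theorem Prefix.Before.cons {Q : Prefix} {k : Quant} {u x y : ℕ} (hx : x ≠ y)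
    (h : Q.Before u x) : Prefix.Before ((k, y) :: Q) u x := by
  by_cases hu : u = y
  · exact hu ▸ Prefix.before_head (hu ▸ hx)
  · simpa [Prefix.Before, Prefix.vars, List.idxOf_cons_ne _ (Ne.symm hx),
      List.idxOf_cons_ne _ (Ne.symm hu)] using h

/-- The literals of `C` occur in `D`, completed by `τ` and up to introducing `*`, as far as the
existential variables of `Q` and the universal variables of `Q` before them are concerned. -/
def Covers (Q : Prefix) (τ : Ann) (C D : AnnClause) : Prop :=
  ∀ l σ, (l, σ) ∈ C → (Quant.ex, l.1) ∈ Q →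
    ∃ ρ, (l, ρ) ∈ D ∧ ∀ u, Q.Before u l.1 → StarLE ((σ u).or (τ u)) (ρ u)

theorem ne_of_nodup_cons {Q : Prefix} {k k' : Quant} {x y : ℕ}
    (hQ : (Prefix.vars ((k, y) :: Q)).Nodup) (hx : (k', x) ∈ Q) : x ≠ y := by
  rintro rfl
  exact (List.nodup_cons.1 hQ).1 (Prefix.mem_vars hx)

theorem nodup_tail {Q : Prefix} {y : Quant × ℕ}
    (hQ : (Prefix.vars (y :: Q)).Nodup) : Q.vars.Nodup := (List.nodup_cons.1 hQ).2

theorem Covers.tail {Q : Prefix} {τ : Ann} {C D : AnnClause} {y : Quant × ℕ}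
    (hQ : (Prefix.vars (y :: Q)).Nodup) (h : Covers (y :: Q) τ C D) : Covers Q τ C D := by
  intro l σ hl hx
  obtain ⟨ρ, hρ, h⟩ := h l σ hl (List.mem_cons_of_mem _ hx)
  exact ⟨ρ, hρ, fun u hu => h u (hu.cons (ne_of_nodup_cons hQ hx))⟩

theorem Covers.selectVal {Q : Prefix} {τ : Ann} {C D : AnnClause} {u : ℕ} {b : Bool}
    (hQ : (Prefix.vars ((Quant.all, u) :: Q)).Nodup) (h : Covers ((Quant.all, u) :: Q) τ C D) :
    Covers Q τ (C.selectVal u b) (D.selectVal u b) := by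
  rintro l σ ⟨hl, c, hc, hcb⟩ hx
  obtain ⟨ρ, hρ, h⟩ := h l σ hl (List.mem_cons_of_mem _ hx)
  have hne := ne_of_nodup_cons hQ hx
  refine ⟨ρ, ⟨hρ, (h u (Prefix.before_head hne)).matches ⟨c, ?_, hcb⟩⟩,
    fun v hv => h v (hv.cons hne)⟩
  change σ u = some c at hc
  simp [hc]

theorem Covers.selectNone {Q : Prefix} {τ : Ann} {C D : AnnClause} {u : ℕ}
    (hQ : (Prefix.vars ((Quant.all, u) :: Q)).Nodup) (h : Covers ((Quant.all, u) :: Q) τ C D)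
    (hτ : τ u = none) : Covers Q τ (C.selectNone u) (D.selectNone u) := by
  rintro l σ ⟨hl, hc⟩ hx
  obtain ⟨ρ, hρ, h⟩ := h l σ hl (List.mem_cons_of_mem _ hx)
  have hne := ne_of_nodup_cons hQ hx
  refine ⟨ρ, ⟨hρ, (h u (Prefix.before_head hne)).eq_none ?_⟩, fun v hv => h v (hv.cons hne)⟩
  change σ u = none at hc
  simp [hc, hτ]

/-- Literals that are unannotated at `u` receive the value of `τ` there, so they survive once the
player commits to a matching bit. -/
theorem Covers.selectNone_selectVal {Q : Prefix} {τ : Ann} {C D : AnnClause} {u : ℕ} {b : Bool}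
    {c : Val} (hQ : (Prefix.vars ((Quant.all, u) :: Q)).Nodup)
    (h : Covers ((Quant.all, u) :: Q) τ C D) (hτ : τ u = some c) (hcb : c.Matches b) :
    Covers Q τ (C.selectNone u) (D.selectVal u b) := by
  rintro l σ ⟨hl, hc⟩ hx
  obtain ⟨ρ, hρ, h⟩ := h l σ hl (List.mem_cons_of_mem _ hx)
  have hne := ne_of_nodup_cons hQ hx
  refine ⟨ρ, ⟨hρ, (h u (Prefix.before_head hne)).matches ⟨c, ?_, hcb⟩⟩,
    fun v hv => h v (hv.cons hne)⟩
  change σ u = none at hc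
  simp [hc, hτ]

/-- The strategy is kept, except in an uncommitted round at a variable where `τ` is defined: it wins
there for both bits, in particular for one matching `τ`. Instantiation, merging, weakening and the
removal of irrelevant literals are all instances. -/
theorem Win.of_covers {φ : CNF} {Q : Prefix} {α : ℕ → Bool} {C D : AnnClause} {τ : Ann}
    (hQ : Q.vars.Nodup) (h : Win φ Q α C) (hCD : Covers Q τ C D) : Win φ Q α D := by
  induction Q generalizing α C D with
  | nil => exact h
  | cons y Q ih =>
    obtain ⟨_ | _, x⟩ := y
    · intro b
      rcases h b with ⟨σ, hσ⟩ | h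
      · obtain ⟨ρ, hρ, -⟩ := hCD _ _ hσ List.mem_cons_self
        exact .inl ⟨ρ, hρ⟩
      · exact .inr (ih (nodup_tail hQ) h (hCD.tail hQ))
    · rcases h with ⟨b, h⟩ | h
      · exact .inl ⟨b, ih (nodup_tail hQ) h (hCD.selectVal hQ)⟩
      · rcases hτ : τ x with _ | c
        · exact .inr fun b => ih (nodup_tail hQ) (h b) (hCD.selectNone hQ hτ)
        · obtain ⟨b, hb⟩ := c.exists_matches
          exact .inl ⟨b, ih (nodup_tail hQ) (h b) (hCD.selectNone_selectVal hQ hτ hb)⟩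

theorem Covers.refl (Q : Prefix) (C : AnnClause) : Covers Q (fun _ => none) C C :=
  fun l σ hl _ => ⟨σ, hl, fun u _ => by simpa using StarLE.refl (σ u)⟩

theorem Covers.mono_left {Q : Prefix} {τ : Ann} {C C' D : AnnClause} (h : Covers Q τ C D)
    (hC : C' ⊆ C) : Covers Q τ C' D := fun l σ hl => h l σ (hC hl)

theorem Win.mono {φ : CNF} {Q : Prefix} {α : ℕ → Bool} {C D : AnnClause}
    (hQ : Q.vars.Nodup) (h : Win φ Q α C) (hCD : C ⊆ D) : Win φ Q α D :=
  h.of_covers hQ ((Covers.refl Q D).mono_left hCD)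

/-! ### Strategies for a clause with a pivot, and resolution -/

theorem AnnClause.selectVal_insert_subset {C : AnnClause} {m : AnnLit} {u : ℕ} {b : Bool} :
    AnnClause.selectVal (insert m C) u b ⊆ insert m (C.selectVal u b) := by
  rintro n ⟨rfl | hn, h⟩
  · exact .inl rfl
  · exact .inr ⟨hn, h⟩

theorem AnnClause.selectVal_insert_subset_of_not {C : AnnClause} {m : AnnLit} {u : ℕ} {b : Bool}
    (hm : ¬ ∃ c, m.2 u = some c ∧ c.Matches b) :
    AnnClause.selectVal (insert m C) u b ⊆ C.selectVal u b := by
  rintro n ⟨rfl | hn, h⟩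
  · exact absurd h hm
  · exact ⟨hn, h⟩

theorem AnnClause.selectNone_insert_subset {C : AnnClause} {m : AnnLit} {u : ℕ} :
    AnnClause.selectNone (insert m C) u ⊆ insert m (C.selectNone u) := by
  rintro n ⟨rfl | hn, h⟩
  · exact .inl rfl
  · exact .inr ⟨hn, h⟩

theorem AnnClause.selectNone_insert_subset_of_ne {C : AnnClause} {m : AnnLit} {u : ℕ}
    (hm : m.2 u ≠ none) : AnnClause.selectNone (insert m C) u ⊆ C.selectNone u := by
  rintro n ⟨rfl | hn, h⟩
  · exact absurd h hm
  · exact ⟨hn, h⟩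

/-- If the first move on a universal variable removes the literal `m`, then `m` can be dropped. -/
theorem Win.all_insert {φ : CNF} {Q : Prefix} {α : ℕ → Bool} {C : AnnClause} {m : AnnLit} {u : ℕ}
    (hQ : (Prefix.vars ((Quant.all, u) :: Q)).Nodup)
    (h : Win φ ((Quant.all, u) :: Q) α (insert m C)) :
    Win φ ((Quant.all, u) :: Q) α C ∨
    (∃ b c, m.2 u = some c ∧ c.Matches b ∧
      Win φ Q (Function.update α u b) (insert m (C.selectVal u b))) ∨
    (m.2 u = none ∧ ∀ b, Win φ Q (Function.update α u b) (insert m (C.selectNone u))) := by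
  have hQ' := nodup_tail hQ
  rcases h with ⟨b, h⟩ | h
  · by_cases hm : ∃ c, m.2 u = some c ∧ c.Matches b
    · obtain ⟨c, hc, hb⟩ := hm
      exact .inr (.inl ⟨b, c, hc, hb, h.mono hQ' AnnClause.selectVal_insert_subset⟩)
    · exact .inl (.inl ⟨b, h.mono hQ' (AnnClause.selectVal_insert_subset_of_not hm)⟩)
  · by_cases hm : m.2 u = none
    · exact .inr (.inr ⟨hm, fun b => (h b).mono hQ' AnnClause.selectNone_insert_subset⟩)
    · exact .inl (.inr fun b => (h b).mono hQ' (AnnClause.selectNone_insert_subset_of_ne hm))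

/-- Coverage ignores literals whose variable is not existential in `Q`. This removes a pivot that
has already been played or that belongs to the other half. -/
theorem Covers.insert_of_notMem {Q : Prefix} {τ : Ann} {C D : AnnClause} {m : AnnLit}
    (hm : (Quant.ex, m.1.1) ∉ Q) (h : Covers Q τ C D) : Covers Q τ (insert m C) D := by
  rintro l σ (rfl | hl) hx
  · exact absurd hx hm
  · exact h l σ hl hx

/-- Both strategies are followed at once. As long as they keep their pivots, their moves on
universal variables are dictated by the pivot annotations, and the disjointness of the domains makes
these moves compatible. When the pivot is played, the premise whose pivot literal became false takes
over. -/
theorem Win.resolve {φ : CNF} {Q : Prefix} {α : ℕ → Bool} {C₁ C₂ E : AnnClause} {x : ℕ}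
    {τ ξ σ : Ann} (hQ : Q.vars.Nodup) (hτξ : Disjoint τ.dom ξ.dom) (hτσ : Disjoint τ.dom σ.dom)
    (hξσ : Disjoint ξ.dom σ.dom) (hτ : τ.ZeroOne)
    (h₁ : Win φ Q α (insert ((x, true), Ann.complete τ ξ) C₁))
    (h₂ : Win φ Q α (insert ((x, false), Ann.complete τ σ) C₂))
    (hC₁ : Covers Q σ C₁ E) (hC₂ : Covers Q ξ C₂ E) : Win φ Q α E := by
  induction Q generalizing α C₁ C₂ E with
  | nil => exact h₁
  | cons y Q ih =>
    have hQ' := nodup_tail hQ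
    obtain ⟨_ | _, y⟩ := y
    · intro b
      by_cases hxy : x = y
      · subst hxy
        have hx : (Quant.ex, x) ∉ Q := fun h => (List.nodup_cons.1 hQ).1 (Prefix.mem_vars h)
        -- The premise whose pivot literal is falsified by `b` is continued; `x` is not quantified
        -- again, so its pivot can be dropped.
        cases b
        · rcases h₁ false with ⟨ρ, hρ⟩ | h
          · have hρ : ((x, false), ρ) ∈ C₁ := by simpa using hρ
            obtain ⟨ρ', hρ', -⟩ := hC₁ _ _ hρ List.mem_cons_self
            exact .inl ⟨ρ', hρ'⟩
          · exact .inr (h.of_covers hQ' ((hC₁.tail hQ).insert_of_notMem hx))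
        · rcases h₂ true with ⟨ρ, hρ⟩ | h
          · have hρ : ((x, true), ρ) ∈ C₂ := by simpa using hρ
            obtain ⟨ρ', hρ', -⟩ := hC₂ _ _ hρ List.mem_cons_self
            exact .inl ⟨ρ', hρ'⟩
          · exact .inr (h.of_covers hQ' ((hC₂.tail hQ).insert_of_notMem hx))
      · rcases h₁ b with ⟨ρ, hρ⟩ | h₁
        · have hρ : ((y, b), ρ) ∈ C₁ := by simpa [Ne.symm hxy] using hρ
          obtain ⟨ρ', hρ', -⟩ := hC₁ _ _ hρ List.mem_cons_self
          exact .inl ⟨ρ', hρ'⟩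
        rcases h₂ b with ⟨ρ, hρ⟩ | h₂
        · have hρ : ((y, b), ρ) ∈ C₂ := by simpa [Ne.symm hxy] using hρ
          obtain ⟨ρ', hρ', -⟩ := hC₂ _ _ hρ List.mem_cons_self
          exact .inl ⟨ρ', hρ'⟩
        exact .inr (ih hQ' h₁ h₂ (hC₁.tail hQ) (hC₂.tail hQ))
    · have d₁ : τ y = none ∨ ξ y = none := by
        by_contra! h
        exact Set.disjoint_left.1 hτξ h.1 h.2
      have d₂ : τ y = none ∨ σ y = none := by
        by_contra! h
        exact Set.disjoint_left.1 hτσ h.1 h.2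
      have d₃ : ξ y = none ∨ σ y = none := by
        by_contra! h
        exact Set.disjoint_left.1 hξσ h.1 h.2
      -- A strategy that loses its pivot here already wins for the rest of its premise, which `E`
      -- covers. Otherwise the pivot annotation at `y` reveals whether the strategy commits.
      rcases h₁.all_insert hQ with h₁ | ⟨b₁, c₁, hc₁, hb₁, h₁⟩ | ⟨hn₁, h₁⟩
      · exact h₁.of_covers hQ hC₁
      · rcases h₂.all_insert hQ with h₂ | ⟨b₂, c₂, hc₂, hb₂, h₂⟩ | ⟨hn₂, h₂⟩
        · exact h₂.of_covers hQ hC₂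
        · simp only [Ann.complete] at hc₁ hc₂
          rcases hτy : τ y with _ | c
          -- Both values would come from outside `τ`, making `ξ` and `σ` both defined at `y`.
          · simp_all
          · have e₁ : c = c₁ := by simpa [hτy] using hc₁
            have e₂ : c = c₂ := by simpa [hτy] using hc₂
            subst e₁ e₂
            have hb : b₁ = b₂ := hb₁.eq_of_ne_star (fun h => hτ y (h ▸ hτy)) hb₂
            subst hb
            exact .inl ⟨b₁, ih hQ' h₁ h₂ (hC₁.selectVal hQ) (hC₂.selectVal hQ)⟩
        · simp only [Ann.complete, Option.or_eq_none_iff] at hc₁ hn₂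
          -- Only the first strategy commits. The second one wins for every bit, so it can follow
          -- `b₁`, and `ξ` annotates its unannotated literals accordingly.
          have hξy : ξ y = some c₁ := by simpa [hn₂.1] using hc₁
          exact .inl ⟨b₁, ih hQ' h₁ (h₂ b₁) (hC₁.selectVal hQ)
            (hC₂.selectNone_selectVal hQ hξy hb₁)⟩
      · simp only [Ann.complete, Option.or_eq_none_iff] at hn₁
        rcases h₂.all_insert hQ with h₂ | ⟨b₂, c₂, hc₂, hb₂, h₂⟩ | ⟨hn₂, h₂⟩
        · exact h₂.of_covers hQ hC₂
        · have hσy : σ y = some c₂ := by simpa [Ann.complete, hn₁.1] using hc₂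
          exact .inl ⟨b₂, ih hQ' (h₁ b₂) h₂ (hC₁.selectNone_selectVal hQ hσy hb₂)
            (hC₂.selectVal hQ)⟩
        · simp only [Ann.complete, Option.or_eq_none_iff] at hn₂
          exact .inr fun b => ih hQ' (h₁ b) (h₂ b) (hC₁.selectNone hQ hn₂.2)
            (hC₂.selectNone hQ hn₁.2)

/-- A clause `C` of `φ`, annotated by the falsifying assignment `τ` of its universal literals. -/
theorem Win.of_mem {φ : CNF} {Q : Prefix} {α : ℕ → Bool} {C : Clause} {K : AnnClause} {τ : Ann}
    (hC : C ∈ φ) (hQ : Q.vars.Nodup) (hnt : ∀ x, ¬ ((x, true) ∈ C ∧ (x, false) ∈ C))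
    (hτ : ∀ u, (Quant.all, u) ∈ Q → τ u =
      if (u, true) ∈ C then some .zero else if (u, false) ∈ C then some .one else none)
    (hex : ∀ l ∈ C, (Quant.ex, l.1) ∈ Q → ∃ σ, (l, σ) ∈ K ∧ ∀ u, Q.Before u l.1 → σ u = τ u)
    (hα : ∀ l ∈ C, l.1 ∉ Q.vars → α l.1 ≠ l.2) : Win φ Q α K := by
  induction Q generalizing α K with
  | nil =>
    intro h
    obtain ⟨l, hl, h⟩ := h C hC
    exact hα l hl (by simp [Prefix.vars]) h
  | cons y Q ih =>
    have hQ' := nodup_tail hQ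
    have hα' : ∀ b, (y.2, b) ∉ C → ∀ l ∈ C, l.1 ∉ Prefix.vars Q →
        Function.update α y.2 b l.1 ≠ l.2 := by
      intro b hb l hl hlQ
      by_cases hly : l.1 = y.2
      · rw [hly, Function.update_self]
        rintro rfl
        exact hb (hly ▸ hl)
      · rw [Function.update_of_ne hly]
        exact hα l hl (by simpa [Prefix.vars, hly] using hlQ)
    have hτ' : ∀ u, (Quant.all, u) ∈ Q → τ u =
        if (u, true) ∈ C then some .zero else if (u, false) ∈ C then some .one else none :=
      fun u hu => hτ u (List.mem_cons_of_mem _ hu)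
    obtain ⟨_ | _, y⟩ := y
    · intro b
      by_cases hb : (y, b) ∈ C
      · obtain ⟨σ, hσ, -⟩ := hex _ hb List.mem_cons_self
        exact .inl ⟨σ, hσ⟩
      · refine .inr (ih hQ' hτ' (fun l hl hx => ?_) (hα' b hb))
        obtain ⟨σ, hσ, h⟩ := hex l hl (List.mem_cons_of_mem _ hx)
        exact ⟨σ, hσ, fun u hu => h u (hu.cons (ne_of_nodup_cons hQ hx))⟩
    · have hy := hτ y List.mem_cons_self
      -- If `C` has a literal on `y`, the bit falsifying it agrees with `τ`, so all relevant
      -- literals of `K` survive the commitment.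
      have sel : ∀ b c, τ y = some c → c.Matches b → (y, b) ∉ C →
          Win φ ((Quant.all, y) :: Q) α K := by
        intro b c hc hcb hb
        refine .inl ⟨b, ih hQ' hτ' (fun l hl hx => ?_) (hα' b hb)⟩
        obtain ⟨σ, hσ, h⟩ := hex l hl (List.mem_cons_of_mem _ hx)
        have hne := ne_of_nodup_cons hQ hx
        exact ⟨σ, ⟨hσ, c, (h y (Prefix.before_head hne)).trans hc, hcb⟩,
          fun u hu => h u (hu.cons hne)⟩
      by_cases ht : (y, true) ∈ C
      · exact sel false .zero (by simp [hy, ht]) (.inr rfl) fun hf => hnt y ⟨ht, hf⟩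
      by_cases hf : (y, false) ∈ C
      · exact sel true .one (by simp [hy, ht, hf]) (.inr rfl) ht
      · refine .inr fun b => ih hQ' hτ' (fun l hl hx => ?_) (hα' b (by cases b <;> assumption))
        obtain ⟨σ, hσ, h⟩ := hex l hl (List.mem_cons_of_mem _ hx)
        have hne := ne_of_nodup_cons hQ hx
        exact ⟨σ, ⟨hσ, (h y (Prefix.before_head hne)).trans (by simp [hy, ht, hf])⟩,
          fun u hu => h u (hu.cons hne)⟩

/-! ## Soundness of the rules for one of the two parts of the matrix -/

/-- An absent variable has the length of the prefix as its index, so it precedes nothing. -/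
theorem Prefix.Before.mem {Q : Prefix} {u x : ℕ} (h : Q.Before u x) : u ∈ Q.vars :=
  List.idxOf_lt_length_iff.1 (h.trans_le List.idxOf_le_length)

theorem Prefix.Before.append {R Q S : Prefix} (hn : (Prefix.vars (R ++ Q ++ S)).Nodup)
    {u x : ℕ} (hx : x ∈ Q.vars) (h : Q.Before u x) : Prefix.Before (R ++ Q ++ S) u x := by
  have hu := h.mem
  have hv : Prefix.vars (R ++ Q ++ S) = R.vars ++ (Q.vars ++ S.vars) := by simp [Prefix.vars]
  have hR : ∀ y ∈ Q.vars, y ∉ R.vars := by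
    intro y hy hyR
    rw [hv] at hn
    exact (List.nodup_append.1 hn).2.2 y hyR y (List.mem_append_left _ hy) rfl
  rw [Prefix.Before, hv, List.idxOf_append_of_notMem (hR u hu),
    List.idxOf_append_of_notMem (hR x hx), List.idxOf_append_of_mem hu,
    List.idxOf_append_of_mem hx]
  exact Nat.add_lt_add_left h _

/-- `Q` is a segment of the prefix `R`: its quantified variables are quantified in `R` in the
same way and in the same order. -/
structure Segment (Q R : Prefix) : Prop where
  nodup : Q.vars.Nodup
  subset : Q ⊆ R
  before : ∀ u x, x ∈ Q.vars → Q.Before u x → R.Before u x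

theorem Segment.append {R Q S : Prefix} (hn : (Prefix.vars (R ++ Q ++ S)).Nodup) :
    Segment Q (R ++ Q ++ S) where
  nodup := by
    refine hn.sublist (List.Sublist.map _ ?_)
    rw [List.append_assoc]
    exact (List.sublist_append_left _ _).trans (List.sublist_append_right _ _)
  subset := by
    intro y hy
    simp [hy]
  before _ _ hx h := h.append hn hx

theorem SplitQBF.WellFormed.segment_q {F : SplitQBF} (h : F.WellFormed) :
    Segment F.q F.quants := Segment.append h.nodup

theorem SplitQBF.WellFormed.segment_r {F : SplitQBF} (h : F.WellFormed) :
    Segment F.r F.quants := by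
  have := Segment.append (R := F.p.map (fun x => (Quant.ex, x)) ++ F.q) (Q := F.r) (S := [])
    (by simpa [SplitQBF.quants] using h.nodup)
  simpa [SplitQBF.quants] using this

theorem SplitQBF.WellFormed.disjoint {F : SplitQBF} (h : F.WellFormed) {x : ℕ} (hx : x ∈ F.p) :
    x ∉ F.q.vars ∧ x ∉ F.r.vars := by
  have hv : F.quants.vars = F.p ++ (F.q.vars ++ F.r.vars) := by
    simp [Prefix.vars, SplitQBF.quants]
  have hn := h.nodup
  rw [hv] at hn
  have := (List.nodup_append.1 hn).2.2 x hx
  constructor <;> intro hx' <;> exact this x (by simp [hx']) rfl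

theorem SplitQBF.WellFormed.disjoint_q_r {F : SplitQBF} (h : F.WellFormed) {x : ℕ}
    (hx : x ∈ F.q.vars) : x ∉ F.r.vars := by
  have hv : F.quants.vars = F.p ++ (F.q.vars ++ F.r.vars) := by
    simp [Prefix.vars, SplitQBF.quants]
  have hn := h.nodup
  rw [hv] at hn
  intro hx'
  exact (List.nodup_append.1 (List.nodup_append.1 hn).2.1).2.2 x hx x hx' rfl

theorem Segment.covers_instantiate {Q R : Prefix} (h : Segment Q R) (τ : Ann) (C : AnnClause) :
    Covers Q τ C (instantiate R τ C) := by
  intro l σ hl hx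
  refine ⟨_, ⟨l, σ, hl, rfl⟩, fun u hu => ?_⟩
  rw [if_pos (h.before u l.1 (Prefix.mem_vars hx) hu)]
  exact StarLE.refl _

theorem Ann.starLE_merge {μ σ : Ann} (h : μ.dom = σ.dom) (u : ℕ) :
    StarLE (μ u) (Ann.merge μ σ u) ∧ StarLE (σ u) (Ann.merge μ σ u) := by
  have hd : μ u = none ↔ σ u = none := by
    simpa [Ann.dom, not_iff_not] using Set.ext_iff.1 h u
  unfold Ann.merge StarLE
  rcases hμ : μ u with _ | c <;> rcases hσ : σ u with _ | d
  · simp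
  · simp [hμ, hσ] at hd
  · simp [hμ, hσ] at hd
  · by_cases hcd : c = d <;> simp [hcd]

/-- Merging only turns values into `*`, which matches every bit, and leaves the domain unchanged. -/
theorem covers_merge {Q : Prefix} {b : Literal} {μ σ : Ann} (h : μ.dom = σ.dom) (C : AnnClause) :
    Covers Q (fun _ => none) (insert (b, μ) (insert (b, σ) C))
      (insert (b, Ann.merge μ σ) C) := by
  rintro l ρ (hl | hl | hl) -
  · cases hl
    exact ⟨_, .inl rfl, fun u _ => by simpa using (Ann.starLE_merge h u).1⟩
  · cases hl
    exact ⟨_, .inl rfl, fun u _ => by simpa using (Ann.starLE_merge h u).2⟩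
  · exact ⟨ρ, .inr hl, fun u _ => by simpa using StarLE.refl (ρ u)⟩

/-- A literal of `C` on one of the variables `p` is satisfied by `a`. -/
def TrueAt (p : List ℕ) (a : ℕ → Bool) (C : AnnClause) : Prop :=
  ∃ l σ, (l, σ) ∈ C ∧ l.1 ∈ p ∧ a l.1 = l.2

/-- The clause `C` is a consequence of `φ` under the assignment `a` of the variables `p`. -/
def Valid (p : List ℕ) (φ : CNF) (Q : Prefix) (a : ℕ → Bool) (C : AnnClause) : Prop :=
  TrueAt p a C ∨ Win φ Q a C

theorem TrueAt.instantiate {p : List ℕ} {a : ℕ → Bool} {C : AnnClause} (h : TrueAt p a C)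
    (R : Prefix) (τ : Ann) : TrueAt p a (instantiate R τ C) := by
  obtain ⟨l, σ, hl, h⟩ := h
  exact ⟨l, _, ⟨l, σ, hl, rfl⟩, h⟩

theorem TrueAt.mono {p : List ℕ} {a : ℕ → Bool} {C D : AnnClause} (h : TrueAt p a C)
    (hCD : C ⊆ D) : TrueAt p a D := by
  obtain ⟨l, σ, hl, h⟩ := h
  exact ⟨l, σ, hCD hl, h⟩

theorem TrueAt.of_insert {p : List ℕ} {a : ℕ → Bool} {C : AnnClause} {m : AnnLit}
    (h : TrueAt p a (insert m C)) (hm : m.1.1 ∈ p → a m.1.1 ≠ m.1.2) : TrueAt p a C := by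
  obtain ⟨l, σ, rfl | hl, hp, ha⟩ := h
  · exact absurd ha (hm hp)
  · exact ⟨l, σ, hl, hp, ha⟩

/-! ### Preservation of validity by the rules -/

section Rules

variable {p : List ℕ} {φ : CNF} {Q R : Prefix} {a : ℕ → Bool}

theorem Valid.mono {C D : AnnClause} (hQ : Q.vars.Nodup) (h : Valid p φ Q a C) (hCD : C ⊆ D) :
    Valid p φ Q a D := h.imp (·.mono hCD) (·.mono hQ hCD)

theorem Valid.instantiate {C : AnnClause} (hQR : Segment Q R) (h : Valid p φ Q a C) (τ : Ann) :
    Valid p φ Q a (instantiate R τ C) :=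
  h.imp (·.instantiate R τ) (·.of_covers hQR.nodup (hQR.covers_instantiate τ C))

theorem Valid.of_insert {C : AnnClause} {m : AnnLit} (hQ : Q.vars.Nodup)
    (h : Valid p φ Q a (insert m C)) (hm : m.1.1 ∈ p → a m.1.1 ≠ m.1.2) (hmQ : m.1.1 ∉ Q.vars) :
    Valid p φ Q a C :=
  h.imp (·.of_insert hm) (·.of_covers hQ
    ((Covers.refl Q C).insert_of_notMem fun h => hmQ (Prefix.mem_vars h)))

theorem Valid.instRule {D E : AnnClause} (hQR : Segment Q R) (hE : InstRule R D E)
    (h : Valid p φ Q a D) : Valid p φ Q a E := by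
  obtain ⟨τ, -, -, rfl⟩ := hE
  exact h.instantiate hQR τ

theorem Valid.mergeRule {D E : AnnClause} (hQ : Q.vars.Nodup) (hE : MergeRule D E)
    (h : Valid p φ Q a D) : Valid p φ Q a E := by
  obtain ⟨b, μ, σ, C, hd, rfl, rfl⟩ := hE
  refine h.imp ?_ (·.of_covers hQ (covers_merge hd C))
  rintro ⟨l, ρ, hl | hl | hl, hp⟩
  · cases hl
    exact ⟨b, _, .inl rfl, hp⟩
  · cases hl
    exact ⟨b, _, .inl rfl, hp⟩
  · exact ⟨l, ρ, .inr hl, hp⟩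

/-- For a half in which the pivot is not quantified, one premise suffices, provided its pivot
literal is not made true by `a`. -/
theorem Valid.resRule_left {x : ℕ} {D₁ D₂ E : AnnClause} (hQR : Segment Q R)
    (hE : ResRule R x D₁ D₂ E) (hxp : x ∈ p → a x = false) (hxQ : x ∉ Q.vars)
    (h : Valid p φ Q a D₁) : Valid p φ Q a E := by
  obtain ⟨τ, ξ, σ, C₁, C₂, -, -, -, -, rfl, rfl, rfl⟩ := hE
  exact ((h.of_insert hQR.nodup (fun hx => by simp [hxp hx]) hxQ).instantiate hQR σ).mono
    hQR.nodup Set.subset_union_left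

theorem Valid.resRule_right {x : ℕ} {D₁ D₂ E : AnnClause} (hQR : Segment Q R)
    (hE : ResRule R x D₁ D₂ E) (hxp : x ∈ p → a x = true) (hxQ : x ∉ Q.vars)
    (h : Valid p φ Q a D₂) : Valid p φ Q a E := by
  obtain ⟨τ, ξ, σ, C₁, C₂, -, -, -, -, rfl, rfl, rfl⟩ := hE
  exact ((h.of_insert hQR.nodup (fun hx => by simp [hxp hx]) hxQ).instantiate hQR ξ).mono
    hQR.nodup Set.subset_union_right

theorem Valid.resRule {x : ℕ} {D₁ D₂ E : AnnClause} (hQR : Segment Q R)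
    (hE : ResRule R x D₁ D₂ E) (hxp : x ∉ p) (h₁ : Valid p φ Q a D₁) (h₂ : Valid p φ Q a D₂) :
    Valid p φ Q a E := by
  obtain ⟨τ, ξ, σ, C₁, C₂, hτξ, hτσ, hξσ, hτ, rfl, rfl, rfl⟩ := hE
  rcases h₁ with h₁ | h₁
  · exact .inl (((h₁.of_insert fun h => absurd h hxp).instantiate R σ).mono
      Set.subset_union_left)
  rcases h₂ with h₂ | h₂
  · exact .inl (((h₂.of_insert fun h => absurd h hxp).instantiate R ξ).mono
      Set.subset_union_right)
  refine .inr (h₁.resolve hQR.nodup hτξ hτσ hξσ hτ h₂ ?_ ?_)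
  · intro l ρ hl hx
    obtain ⟨ρ', hρ', h⟩ := hQR.covers_instantiate σ C₁ l ρ hl hx
    exact ⟨ρ', .inl hρ', h⟩
  · intro l ρ hl hx
    obtain ⟨ρ', hρ', h⟩ := hQR.covers_instantiate ξ C₂ l ρ hl hx
    exact ⟨ρ', .inr hρ', h⟩

/-- If `a` satisfies no literal of `C` on `p`, the universal player wins by falsifying the universal
literals of `C`: the existential player must then satisfy an existential one or falsify `C`. -/
theorem Valid.axiomClause {C : Clause} (hQR : Segment Q R) (hC : C ∈ φ)
    (hnt : ∀ x, ¬ ((x, true) ∈ C ∧ (x, false) ∈ C)) (hp : ∀ x ∈ p, (Quant.ex, x) ∈ R)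
    (hv : ∀ l ∈ C, l.1 ∈ p ∨ l.1 ∈ Q.vars) : Valid p φ Q a (axiomClause R C) := by
  by_cases h : ∃ l ∈ C, l.1 ∈ p ∧ a l.1 = l.2
  · obtain ⟨l, hl, hlp, hal⟩ := h
    exact .inl ⟨l, _, ⟨l, hl, hp _ hlp, rfl⟩, hlp, hal⟩
  · push Not at h
    refine .inr (Win.of_mem (τ := falsifier R C) hC hQR.nodup hnt ?_ ?_ ?_)
    · intro u hu
      simp [falsifier, hQR.subset hu]
    · intro l hl hx
      refine ⟨_, ⟨l, hl, hQR.subset hx, rfl⟩, fun u hu => ?_⟩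
      exact if_pos (hQR.before u l.1 (Prefix.mem_vars hx) hu)
    · exact fun l hl hlQ => h l hl ((hv l hl).resolve_right hlQ)

theorem Valid.not_qTrue (h : Valid p φ Q a ∅) : ¬ QTrue φ Q a := by
  rcases h with ⟨l, σ, h, -⟩ | h
  · exact absurd h (Set.notMem_empty _)
  · exact h.not_qTrue rfl

end Rules

/-- A line with clause `C` and gate value `g`: the value tells for which part `C` is valid. -/
def Interpolates (F : SplitQBF) (a : ℕ → Bool) (C : AnnClause) (g : Bool) : Prop :=
  (g = false → Valid F.p F.A F.q a C) ∧ (g = true → Valid F.p F.B F.r a C)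

/-- The gate value of a line, given the gate values `v` of the lines. -/
def Inference.value (F : SplitQBF) (a : ℕ → Bool) (v : ℕ → Bool) : Inference → Bool
  | .ax C => !decide (C ∈ F.A)
  | .inst i => v i
  | .merge i => v i
  | .res i j x =>
      if x ∈ F.p then bif a x then v j else v i
      else if x ∈ F.q.vars then v i || v j
      else v i && v j

theorem Line.Follows.interpolates {F : SplitQBF} (hF : F.WellFormed) {a v : ℕ → Bool}
    {prev : List Line} {L : Line} (hL : L.Follows F.quants F.matrix prev)
    (hprev : ∀ i P, prev[i]? = some P → Interpolates F a P.clause (v i)) :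
    Interpolates F a L.clause (L.inference.value F a v) := by
  have hq := hF.segment_q
  have hr := hF.segment_r
  unfold Line.Follows at hL
  match hinf : L.inference with
  | .ax C =>
    rw [hinf] at hL
    obtain ⟨hC, hL⟩ := hL
    have hp : ∀ x ∈ F.p, (Quant.ex, x) ∈ F.quants := fun x hx => by
      simp [SplitQBF.quants, hx]
    rw [hL]
    refine ⟨fun h => ?_, fun h => ?_⟩
    · have hA : C ∈ F.A := by simpa [Inference.value] using h
      exact Valid.axiomClause hq hA (hF.not_taut C hC) hp (hF.vars_A C hA)
    -- A clause occurring in both halves counts as a clause of `A`; otherwise it must come from `B`.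
    · have hA : C ∉ F.A := by simpa [Inference.value] using h
      have hB : C ∈ F.B := (List.mem_append.1 hC).resolve_left hA
      exact Valid.axiomClause hr hB (hF.not_taut C hC) hp (hF.vars_B C hB)
  | .inst i =>
    rw [hinf] at hL
    obtain ⟨P, hP, hL⟩ := hL
    have h := hprev i P hP
    exact ⟨fun hg => (h.1 hg).instRule hq hL, fun hg => (h.2 hg).instRule hr hL⟩
  | .merge i =>
    rw [hinf] at hL
    obtain ⟨P, hP, hL⟩ := hL
    have h := hprev i P hP
    exact ⟨fun hg => (h.1 hg).mergeRule hq.nodup hL, fun hg => (h.2 hg).mergeRule hr.nodup hL⟩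
  | .res i j x =>
    rw [hinf] at hL
    obtain ⟨P₁, P₂, hP₁, hP₂, hL⟩ := hL
    have h₁ := hprev i P₁ hP₁
    have h₂ := hprev j P₂ hP₂
    by_cases hxp : x ∈ F.p
    · obtain ⟨hxq, hxr⟩ := hF.disjoint hxp
      cases hax : a x
      · simp only [Inference.value, hxp, hax, if_true, cond_false]
        exact ⟨fun hg => (h₁.1 hg).resRule_left hq hL (fun _ => hax) hxq,
          fun hg => (h₁.2 hg).resRule_left hr hL (fun _ => hax) hxr⟩
      · simp only [Inference.value, hxp, hax, if_true, cond_true]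
        exact ⟨fun hg => (h₂.1 hg).resRule_right hq hL (fun _ => hax) hxq,
          fun hg => (h₂.2 hg).resRule_right hr hL (fun _ => hax) hxr⟩
    · by_cases hxq : x ∈ F.q.vars
      · have hxr := hF.disjoint_q_r hxq
        simp only [Inference.value, hxp, hxq, if_true, if_false]
        refine ⟨fun hg => ?_, fun hg => ?_⟩
        · rw [Bool.or_eq_false_iff] at hg
          exact Valid.resRule hq hL hxp (h₁.1 hg.1) (h₂.1 hg.2)
        · rw [Bool.or_eq_true_iff] at hg
          rcases hg with hg | hg
          · exact (h₁.2 hg).resRule_left hr hL (fun h => absurd h hxp) hxr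
          · exact (h₂.2 hg).resRule_right hr hL (fun h => absurd h hxp) hxr
      -- The pivot need not lie in `r`: all that matters is that the game for `A` does not contain
      -- it.
      · simp only [Inference.value, hxp, hxq, if_false]
        refine ⟨fun hg => ?_, fun hg => ?_⟩
        · rw [Bool.and_eq_false_iff] at hg
          rcases hg with hg | hg
          · exact (h₁.1 hg).resRule_left hq hL (fun h => absurd h hxp) hxq
          · exact (h₂.1 hg).resRule_right hq hL (fun h => absurd h hxp) hxq
        · rw [Bool.and_eq_true_iff] at hg
          exact Valid.resRule hr hL hxp (h₁.2 hg.1) (h₂.2 hg.2)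

/-- The bits enter only through their recurrence, so the gate values of the circuit can be
substituted for `v`. -/
theorem interpolates_of_value {F : SplitQBF} (hF : F.WellFormed) {a v : ℕ → Bool} {π : Proof}
    (hπ : ∀ (k : ℕ) (L : Line), π[k]? = some L → L.Follows F.quants F.matrix (π.take k))
    (hv : ∀ k L, π[k]? = some L → v k = L.inference.value F a v) (k : ℕ) (L : Line)
    (hL : π[k]? = some L) : Interpolates F a L.clause (v k) := by
  induction k using Nat.strong_induction_on generalizing L with
  | _ k ih =>
    rw [hv k L hL]
    refine (hπ k L hL).interpolates hF fun i P hP => ?_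
    have hi : i < k := by
      by_contra h
      simp [h] at hP
    exact ih i hi P (by simpa [List.getElem?_take, hi] using hP)

/-! ## The interpolation circuit -/

theorem Circuit.values_append (a : ℕ → Bool) (G : Circuit) (g : Gate) :
    Circuit.values a (G ++ [g]) = G.values a ++ [g.eval a (G.values a)] := by
  simp [Circuit.values]

theorem Circuit.length_values (a : ℕ → Bool) (G : Circuit) : (G.values a).length = G.length := by
  induction G using List.reverseRecOn with
  | nil => rfl
  | append_singleton G g ih => simp [Circuit.values_append, ih]

/-- The value of the gate with number `k`. -/
def Circuit.gateValue (a : ℕ → Bool) (G : Circuit) (k : ℕ) : Bool := (G.values a).getD k false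

theorem Gate.eval_append {X : List ℕ} {a : ℕ → Bool} {g : Gate} {vals w : List Bool} {k : ℕ}
    (h : g.Admissible X k) (hk : k ≤ vals.length) : g.eval a (vals ++ w) = g.eval a vals := by
  have get : ∀ i < k, (vals ++ w)[i]? = vals[i]? := fun i hi =>
    List.getElem?_append_left (hi.trans_le hk)
  cases g <;> simp_all [Gate.eval, Gate.Admissible]

/-- Admissible gates read only earlier values, which appending gates does not change; hence each
gate satisfies its local equation in the whole circuit. -/
theorem Circuit.gateValue_eq {X : List ℕ} {a : ℕ → Bool} {G : Circuit}
    (hG : ∀ (k : ℕ) (g : Gate), G[k]? = some g → g.Admissible X k) {k : ℕ} {g : Gate}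
    (hk : G[k]? = some g) : G.gateValue a k = g.eval a (G.values a) := by
  induction G using List.reverseRecOn with
  | nil => simp at hk
  | append_singleton G h ih =>
    have hlt : ∀ i < G.length, (G ++ [h])[i]? = G[i]? := fun i hi =>
      List.getElem?_append_left hi
    have hGadm : ∀ (k : ℕ) (g : Gate), G[k]? = some g → g.Admissible X k := fun i g hi =>
      hG i g ((hlt i (List.getElem?_eq_some_iff.1 hi).1).trans hi)
    have hadm := hG k g hk
    have hkle : k ≤ G.length := by
      simpa [Nat.lt_succ_iff] using (List.getElem?_eq_some_iff.1 hk).1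
    rw [Circuit.gateValue, Circuit.values_append,
      Gate.eval_append hadm (by rwa [Circuit.length_values])]
    rcases Nat.lt_or_ge k G.length with hkG | hkG
    · rw [List.getD_append _ _ _ _ (by rwa [Circuit.length_values])]
      exact ih hGadm ((hlt k hkG).symm.trans hk)
    · obtain rfl := Nat.le_antisymm hkle hkG
      obtain rfl : h = g := by simpa using hk
      simp [← Circuit.length_values a]

/-- The five gates of the line with number `k`; the last one computes the value of the line. -/
def Inference.gates (F : SplitQBF) (k : ℕ) : Inference → List Gate
  | .ax C => List.replicate 4 (.const false) ++ [.const !decide (C ∈ F.A)]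
  | .inst i => List.replicate 4 (.const false) ++ [.or (5 * i + 4) (5 * i + 4)]
  | .merge i => List.replicate 4 (.const false) ++ [.or (5 * i + 4) (5 * i + 4)]
  | .res i j x =>
      if x ∈ F.p then
        -- The selector `(x ∧ vⱼ) ∨ (¬x ∧ vᵢ)`.
        [.input x, .not (5 * k), .and (5 * k) (5 * j + 4), .and (5 * k + 1) (5 * i + 4),
          .or (5 * k + 2) (5 * k + 3)]
      else List.replicate 4 (.const false) ++
        [if x ∈ F.q.vars then .or (5 * i + 4) (5 * j + 4) else .and (5 * i + 4) (5 * j + 4)]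

/-- Dummy constants pad every block to the length of the selector, so line `k` has its output at
gate `5 * k + 4` and no offsets have to be tracked. -/
theorem Inference.length_gates (F : SplitQBF) (k : ℕ) (I : Inference) :
    (I.gates F k).length = 5 := by
  cases I <;> simp only [Inference.gates]
  case res => split_ifs <;> rfl
  all_goals rfl

/-- The interpolation circuit that is extracted from a refutation. -/
def extractCircuit (F : SplitQBF) (π : Proof) : Circuit :=
  (List.range π.length).flatMap fun k => (π[k]?.map fun L => L.inference.gates F k).getD []

theorem extractCircuit_concat (F : SplitQBF) (π : Proof) (L : Line) :
    extractCircuit F (π ++ [L]) = extractCircuit F π ++ L.inference.gates F π.length := by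
  unfold extractCircuit
  rw [List.length_append, List.length_singleton, List.range_succ, List.flatMap_append]
  congr 1
  · refine List.flatMap_congr fun k hk => ?_
    rw [List.getElem?_append_left (List.mem_range.1 hk)]
  · simp

theorem length_extractCircuit (F : SplitQBF) (π : Proof) :
    (extractCircuit F π).length = 5 * π.length := by
  induction π using List.reverseRecOn with
  | nil => rfl
  | append_singleton π L ih =>
    simp [extractCircuit_concat, ih, Inference.length_gates, Nat.mul_add]

theorem getElem?_extractCircuit {F : SplitQBF} {π : Proof} {k j : ℕ} (hj : j < 5) {L : Line}
    (hL : π[k]? = some L) :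
    (extractCircuit F π)[5 * k + j]? = (L.inference.gates F k)[j]? := by
  induction π using List.reverseRecOn with
  | nil => simp at hL
  | append_singleton π L' ih =>
    rw [extractCircuit_concat]
    have hk : k ≤ π.length := by
      simpa [Nat.lt_succ_iff] using (List.getElem?_eq_some_iff.1 hL).1
    rcases Nat.lt_or_ge k π.length with hlt | hge
    · rw [List.getElem?_append_left (by rw [length_extractCircuit]; omega)]
      exact ih (by rwa [List.getElem?_append_left hlt] at hL)
    · obtain rfl := Nat.le_antisymm hk hge
      obtain rfl : L' = L := by simpa using hL
      rw [List.getElem?_append_right (by rw [length_extractCircuit]; omega),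
        length_extractCircuit, Nat.add_sub_cancel_left]

/-- Parents have numbers below `k`, so their output gates lie before gate `5 * k`. -/
theorem Line.Follows.admissible {F : SplitQBF} {π : Proof} {k j : ℕ} {L : Line} {g : Gate}
    (hL : L.Follows F.quants F.matrix (π.take k)) (hg : (L.inference.gates F k)[j]? = some g) :
    g.Admissible F.p (5 * k + j) := by
  have hlt : ∀ {i P}, (π.take k)[i]? = some P → i < k := by
    intro i P hP
    by_contra h
    simp [h] at hP
  have hj : j < 5 := by
    simpa [Inference.length_gates] using (List.getElem?_eq_some_iff.1 hg).1
  unfold Line.Follows at hL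
  match hinf : L.inference with
  | .ax C =>
    rw [hinf] at hg
    interval_cases j <;> simp [Inference.gates] at hg <;> subst hg <;> trivial
  | .inst i | .merge i =>
    rw [hinf] at hg hL
    obtain ⟨P, hP, -⟩ := hL
    have := hlt hP
    interval_cases j <;> simp [Inference.gates] at hg <;> subst hg <;>
      simp only [Gate.Admissible] <;> omega
  | .res i j' x =>
    rw [hinf] at hg hL
    obtain ⟨P₁, P₂, hP₁, hP₂, -⟩ := hL
    have h₁ := hlt hP₁
    have h₂ := hlt hP₂
    simp only [Inference.gates] at hg
    by_cases hxp : x ∈ F.p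
    · interval_cases j <;> simp [hxp] at hg <;> subst hg <;>
        simp only [Gate.Admissible] <;> (first | exact hxp | omega)
    · by_cases hxq : x ∈ F.q.vars <;> interval_cases j <;> simp [hxp, hxq] at hg <;> subst hg <;>
        simp only [Gate.Admissible] <;> omega

/-! ### Correctness of the extracted circuit -/

section Refutation

variable {F : SplitQBF} {π : Proof}

theorem admissible_extractCircuit
    (hπ : ∀ (k : ℕ) (L : Line), π[k]? = some L → L.Follows F.quants F.matrix (π.take k))
    (n : ℕ) (g : Gate) (hg : (extractCircuit F π)[n]? = some g) : g.Admissible F.p n := by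
  have hn := (List.getElem?_eq_some_iff.1 hg).1
  rw [length_extractCircuit] at hn
  have hk : n / 5 < π.length := by omega
  have hL : π[n / 5]? = some π[n / 5] := List.getElem?_eq_getElem hk
  have e : 5 * (n / 5) + n % 5 = n := Nat.div_add_mod n 5
  rw [← e] at hg ⊢
  rw [getElem?_extractCircuit (Nat.mod_lt _ (by norm_num)) hL] at hg
  exact (hπ _ _ hL).admissible hg

theorem gateValue_extractCircuit
    (hπ : ∀ (k : ℕ) (L : Line), π[k]? = some L → L.Follows F.quants F.matrix (π.take k))
    (a : ℕ → Bool) (k : ℕ) (L : Line) (hL : π[k]? = some L) :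
    (extractCircuit F π).gateValue a (5 * k + 4) =
      L.inference.value F a fun i => (extractCircuit F π).gateValue a (5 * i + 4) := by
  have key : ∀ j < 5, ∀ g, (L.inference.gates F k)[j]? = some g →
      (extractCircuit F π).gateValue a (5 * k + j) =
        g.eval a ((extractCircuit F π).values a) := fun j hj g hg =>
    Circuit.gateValue_eq (admissible_extractCircuit hπ)
      ((getElem?_extractCircuit hj hL).trans hg)
  match hinf : L.inference with
  | .ax C | .inst i | .merge i =>
    rw [hinf] at key
    rw [key 4 (by norm_num) _ rfl]
    simp [Gate.eval, Inference.value, Circuit.gateValue]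
  | .res i j x =>
    rw [hinf] at key
    by_cases hxp : x ∈ F.p
    · simp only [Inference.gates, hxp, if_true] at key
      have h₀ := key 0 (by norm_num) _ rfl
      have h₁ := key 1 (by norm_num) _ rfl
      have h₂ := key 2 (by norm_num) _ rfl
      have h₃ := key 3 (by norm_num) _ rfl
      have h₄ := key 4 (by norm_num) _ rfl
      simp only [Gate.eval, Nat.add_zero] at h₀ h₁ h₂ h₃ h₄
      simp only [Circuit.gateValue] at h₀ h₁ h₂ h₃ h₄ ⊢
      rw [h₄, h₃, h₂, h₁, h₀]
      cases hax : a x <;> simp [Inference.value, hxp, hax]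
    · by_cases hxq : x ∈ F.q.vars <;>
        simp only [Inference.gates, hxp, hxq, if_true, if_false] at key <;>
        rw [key 4 (by norm_num) _ rfl] <;>
        simp [Gate.eval, Inference.value, Circuit.gateValue, hxp, hxq]

theorem IsRefutation.isInterpolationCircuit (hF : F.WellFormed)
    (h : IsRefutation F.quants F.matrix π) : IsInterpolationCircuit F (extractCircuit F π) := by
  obtain ⟨hπ, L, hlast, hL⟩ := h
  have hk : π[π.length - 1]? = some L := by rw [← hlast, List.getLast?_eq_getElem?]
  have hpos : 0 < π.length := by
    rcases π with _ | _
    · simp at hlast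
    · simp
  have hlen := length_extractCircuit F π
  refine ⟨⟨?_, admissible_extractCircuit hπ⟩, fun a => ?_⟩
  · intro h
    rw [h, List.length_nil] at hlen
    omega
  -- The last gate of the circuit is the output of the last line, whose clause is empty.
  have heval : (extractCircuit F π).eval a =
      (extractCircuit F π).gateValue a (5 * (π.length - 1) + 4) := by
    have e : 5 * (π.length - 1) + 4 = ((extractCircuit F π).values a).length - 1 := by
      rw [Circuit.length_values, hlen]
      omega
    rw [Circuit.eval, Circuit.gateValue, e, List.getLastD_eq_getLast?,
      List.getLast?_eq_getElem?, List.getD_eq_getElem?_getD]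
  have hI := interpolates_of_value hF (a := a) hπ (gateValue_extractCircuit hπ a) _ L hk
  rw [hL, ← heval] at hI
  exact ⟨fun h => (hI.1 h).not_qTrue, fun h => (hI.2 h).not_qTrue⟩

end Refutation

/-! ## Computability of the extraction -/

section Primrec

variable {α : Type*} [Primcodable α]

theorem SplitQBF.primrec_equiv : Primrec SplitQBF.equiv := Primrec.of_equiv

theorem SplitQBF.primrec_p : Primrec SplitQBF.p := Primrec.fst.comp SplitQBF.primrec_equiv

theorem SplitQBF.primrec_q : Primrec SplitQBF.q :=
  (Primrec.fst.comp Primrec.snd).comp SplitQBF.primrec_equiv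

theorem SplitQBF.primrec_A : Primrec SplitQBF.A :=
  (Primrec.fst.comp (Primrec.snd.comp (Primrec.snd.comp Primrec.snd))).comp
    SplitQBF.primrec_equiv

theorem Line.primrec_inference : Primrec Line.inference :=
  Primrec.snd.comp (Primrec.of_equiv (e := Line.equiv))

theorem primrec_gate_of_sum {f : α → Bool ⊕ ℕ ⊕ ℕ ⊕ (ℕ × ℕ) ⊕ (ℕ × ℕ)} (hf : Primrec f) :
    Primrec fun x => Gate.equiv.symm (f x) :=
  (Primrec.of_equiv_symm (e := Gate.equiv)).comp hf

theorem Gate.primrec_const {f : α → Bool} (hf : Primrec f) : Primrec fun x => Gate.const (f x) :=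
  primrec_gate_of_sum (Primrec.sumInl.comp hf)

theorem Gate.primrec_input {f : α → ℕ} (hf : Primrec f) : Primrec fun x => Gate.input (f x) :=
  primrec_gate_of_sum (Primrec.sumInr.comp (Primrec.sumInl.comp hf))

theorem Gate.primrec_not {f : α → ℕ} (hf : Primrec f) : Primrec fun x => Gate.not (f x) :=
  primrec_gate_of_sum (Primrec.sumInr.comp (Primrec.sumInr.comp (Primrec.sumInl.comp hf)))

theorem Gate.primrec_and {f g : α → ℕ} (hf : Primrec f) (hg : Primrec g) :
    Primrec fun x => Gate.and (f x) (g x) :=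
  primrec_gate_of_sum (Primrec.sumInr.comp (Primrec.sumInr.comp (Primrec.sumInr.comp
    (Primrec.sumInl.comp (hf.pair hg)))))

theorem Gate.primrec_or {f g : α → ℕ} (hf : Primrec f) (hg : Primrec g) :
    Primrec fun x => Gate.or (f x) (g x) :=
  primrec_gate_of_sum (Primrec.sumInr.comp (Primrec.sumInr.comp (Primrec.sumInr.comp
    (Primrec.sumInr.comp (hf.pair hg)))))

/-- Membership amounts to the first index being smaller than the length, and both are primitive
recursive. -/
theorem primrecPred_mem {β : Type*} [Primcodable β] [DecidableEq β] {f : α → β}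
    {l : α → List β} (hf : Primrec f) (hl : Primrec l) : PrimrecPred fun x => f x ∈ l x :=
  (Primrec.nat_lt.comp (Primrec.list_idxOf.comp hf hl) (Primrec.list_length.comp hl)).of_eq
    fun _ => List.idxOf_lt_length_iff

theorem primrec_gateIndex (c : ℕ) {f : α → ℕ} (hf : Primrec f) :
    Primrec fun x => 5 * f x + c :=
  Primrec.nat_add.comp (Primrec.nat_mul.comp (Primrec.const 5) hf) (Primrec.const c)

theorem primrec_singleton {β : Type*} [Primcodable β] {f : α → β} (hf : Primrec f) :
    Primrec fun x => [f x] := Primrec.list_cons.comp hf (Primrec.const [])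

theorem primrec_copyGates {g : α → Gate} (hg : Primrec g) :
    Primrec fun x => List.replicate 4 (Gate.const false) ++ [g x] :=
  Primrec.list_append.comp (Primrec.const _) (primrec_singleton hg)

theorem Inference.primrec_gates {F : α → SplitQBF} {k : α → ℕ} {I : α → Inference}
    (hF : Primrec F) (hk : Primrec k) (hI : Primrec I) :
    Primrec fun x => (I x).gates (F x) (k x) := by
  have hF₁ : ∀ {β : Type} [Primcodable β], Primrec fun y : α × β => F y.1 := hF.comp Primrec.fst
  have hk₁ : ∀ {β : Type} [Primcodable β], Primrec fun y : α × β => k y.1 := hk.comp Primrec.fst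
  have hax : Primrec fun y : α × Clause => Inference.gates (F y.1) (k y.1) (.ax y.2) :=
    primrec_copyGates (Gate.primrec_const (Primrec.not.comp
      (primrecPred_mem Primrec.snd (SplitQBF.primrec_A.comp hF₁)).decide))
  have hcopy : Primrec fun i : ℕ =>
      List.replicate 4 (Gate.const false) ++ [Gate.or (5 * i + 4) (5 * i + 4)] :=
    primrec_copyGates (Gate.primrec_or (primrec_gateIndex 4 .id) (primrec_gateIndex 4 .id))
  have hi : Primrec fun y : α × ℕ × ℕ × ℕ => y.2.1 := Primrec.fst.comp Primrec.snd
  have hj : Primrec fun y : α × ℕ × ℕ × ℕ => y.2.2.1 :=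
    Primrec.fst.comp (Primrec.snd.comp Primrec.snd)
  have hx : Primrec fun y : α × ℕ × ℕ × ℕ => y.2.2.2 :=
    Primrec.snd.comp (Primrec.snd.comp Primrec.snd)
  have hvars : Primrec fun y : α × ℕ × ℕ × ℕ => (F y.1).q.vars :=
    Primrec.list_map (SplitQBF.primrec_q.comp hF₁) (Primrec.snd.comp Primrec.snd)
  have hres : Primrec fun y : α × ℕ × ℕ × ℕ =>
      Inference.gates (F y.1) (k y.1) (.res y.2.1 y.2.2.1 y.2.2.2) := by
    refine Primrec.ite (primrecPred_mem hx (SplitQBF.primrec_p.comp hF₁)) ?_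
      (primrec_copyGates (Primrec.ite (primrecPred_mem hx hvars)
        (Gate.primrec_or (primrec_gateIndex 4 hi) (primrec_gateIndex 4 hj))
        (Gate.primrec_and (primrec_gateIndex 4 hi) (primrec_gateIndex 4 hj))))
    exact Primrec.list_cons.comp (Gate.primrec_input hx) <|
      Primrec.list_cons.comp (Gate.primrec_not (primrec_gateIndex 0 hk₁)) <|
      Primrec.list_cons.comp
        (Gate.primrec_and (primrec_gateIndex 0 hk₁) (primrec_gateIndex 4 hj)) <|
      Primrec.list_cons.comp
        (Gate.primrec_and (primrec_gateIndex 1 hk₁) (primrec_gateIndex 4 hi)) <|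
      primrec_singleton
        (Gate.primrec_or (primrec_gateIndex 2 hk₁) (primrec_gateIndex 3 hk₁))
  have hequiv : Primrec fun x => Inference.equiv (I x) :=
    (Primrec.of_equiv (e := Inference.equiv)).comp hI
  -- Case distinction on the inference through its coding as a nested sum; instantiation and merging
  -- share the copying block.
  refine (Primrec.sumCasesOn hequiv hax.to₂ (Primrec.sumCasesOn Primrec.snd
    (hcopy.comp Primrec.snd).to₂ (Primrec.sumCasesOn Primrec.snd
      (hres.comp (Primrec.pair (Primrec.fst.comp (Primrec.fst.comp Primrec.fst))
        Primrec.snd)).to₂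
      (hcopy.comp Primrec.snd).to₂).to₂).to₂).of_eq fun x => ?_
  cases I x <;> rfl

theorem primrec_extractCircuit :
    Primrec fun z : SplitQBF × Proof => extractCircuit z.1 z.2 := by
  refine Primrec.list_flatMap (Primrec.list_range.comp (Primrec.list_length.comp Primrec.snd)) ?_
  refine Primrec.option_getD.comp (Primrec.option_map
    (Primrec.list_getElem?.comp (Primrec.snd.comp Primrec.fst) Primrec.snd) ?_) (Primrec.const [])
  exact Inference.primrec_gates (Primrec.fst.comp (Primrec.fst.comp Primrec.fst))
    (Primrec.snd.comp Primrec.fst) (Line.primrec_inference.comp Primrec.snd)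

end Primrec

end IRMCalc

theorem theorem3p4 :
    ∃ (extract : IRMCalc.SplitQBF × IRMCalc.Proof → IRMCalc.Circuit) (P : Polynomial ℕ),
      Computable extract ∧
      ∀ (F : IRMCalc.SplitQBF) (π : IRMCalc.Proof), F.WellFormed →
        IRMCalc.IsRefutation F.quants F.matrix π →
          IRMCalc.IsInterpolationCircuit F (extract (F, π)) ∧
          (extract (F, π)).size ≤ P.eval π.size := by
  refine ⟨fun z => IRMCalc.extractCircuit z.1 z.2, 5 * Polynomial.X,
    IRMCalc.primrec_extractCircuit.to_comp, fun F π hF hπ => ⟨hπ.isInterpolationCircuit hF, ?_⟩⟩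
  simp [IRMCalc.Circuit.size, IRMCalc.Proof.size, IRMCalc.length_extractCircuit]
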